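/- Let $\mathsf k$ be a field. For an integer $q \ge 0$ let $[q]=\{1,\dots,q\}$, let $\mathcal S_q = \mathsf k[x_A : \emptyset \ne A \subseteq [q]]$, and let the $q$-extremal ideal be $\mathcal E_q = (\epsilon_1,\dots,\epsilon_q) \subseteq \mathcal S_q$, where $\epsilon_i = \prod_{A \subseteq [q],\, i \in A} x_A$ (so $\mathcal E_0 = 0 \subseteq \mathsf k$). Write $\mathcal E_q^r$ for the $r$-th power of this ideal. For a monomial ideal $I$ in a polynomial ring $S$ over $\mathsf k$ in finitely many variables, label every nonempty set $\sigma$ of minimal monomial generators of $I$ by $\mathbf m_\sigma = \mathrm{lcm}(m : m \in \sigma)$. The Scarf complex $\mathbb S(I)$ is the simplicial complex of those $\sigma$ such that $\mathbf m_\tau \ne \mathbf m_\sigma$ for every nonempty set $\tau \neq \sigma$ of minimal monomial generators. A simplicial complex $\Gamma$ on the minimal monomial generators of $I$ supports a free resolution of $I$ if its homogenized simplicial chain complex is a free resolution of $I$; that is, if $$\cdots \to \bigoplus_{\sigma \in \Gamma,\, |\sigma| = 2} S\,[\sigma] \to \bigoplus_{\sigma \in \Gamma,\, |\sigma| = 1}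 S\,[\sigma] \to I \to 0$$ is exact, where $[\sigma] \mapsto \sum_{v \in \sigma} \pm \frac{\mathbf m_\sigma}{\mathbf m_{\sigma \setminus v}}\, [\sigma \setminus v]$ for $|\sigma| \geq 2$, with the simplicial boundary signs for a total order of the vertices, and $[\{m\}] \mapsto m$. The ideal $I$ is called Scarf if $\mathbb S(I)$ supports a free resolution of $I$. Theorem. Let $q$ and $r$ be positive integers. If $\mathcal E_q^r$ is Scarf, then $\mathcal E_{q-1}^r$ (an ideal of $\mathcal S_{q-1}$) and $\mathcal E_q^{r-1}$ (an ideal of $\mathcal S_q$) are both Scarf. -/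

import Mathlib

namespace ScarfPowers

open MvPolynomial

section MonomialIdeals

variable {k : Type*} [Field k] {σ : Type*}

/-- The (exponent vectors of the) minimal monomial generators of a monomial ideal `I`: the monomials
of `I` that are minimal for divisibility among the monomials of `I`. -/
def minimalGenerators (I : Ideal (MvPolynomial σ k)) : Set (σ →₀ ℕ) :=
  {m | Minimal (fun m : σ →₀ ℕ => monomial m (1 : k) ∈ I) m}

/-- The monomial label of a set of monomials: their least common multiple. Monomials are given by
exponent vectors, so this is the coordinatewise maximum. -/
noncomputable def faceLabel (s : Finset (σ →₀ ℕ)) : σ →₀ ℕ := s.sup id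

theorem faceLabel_mono {s t : Finset (σ →₀ ℕ)} (h : s ⊆ t) : faceLabel s ≤ faceLabel t :=
  Finset.sup_mono h

/-- The Taylor simplex of a monomial ideal: the full simplex on its minimal generators. As `I`
itself (and not the quotient by `I`) is resolved, faces are the nonempty ones. -/
def taylorComplex (I : Ideal (MvPolynomial σ k)) : PreAbstractSimplicialComplex (σ →₀ ℕ) where
  faces := {s | s.Nonempty ∧ (s : Set (σ →₀ ℕ)) ⊆ minimalGenerators I}
  isRelLowerSet_faces := fun _ hs =>
    ⟨hs.1, fun _ hts ht => ⟨ht, fun _ hx => hs.2 (hts hx)⟩⟩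

/-- The faces of the Taylor simplex whose label is shared with no other face. -/
def scarfFaces (I : Ideal (MvPolynomial σ k)) : Set (Finset (σ →₀ ℕ)) :=
  {s | s ∈ taylorComplex I ∧ ∀ t ∈ taylorComplex I, t ≠ s → faceLabel s ≠ faceLabel t}

theorem scarfFaces_subset {I : Ideal (MvPolynomial σ k)} {s t : Finset (σ →₀ ℕ)}
    (hs : s ∈ scarfFaces I) (hts : t ⊆ s) (ht : t.Nonempty) : t ∈ scarfFaces I := by
  classical
  have key : ∀ v ∈ taylorComplex I, faceLabel s = faceLabel v → v = s := by
    intro v hv h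
    by_contra hne
    exact hs.2 v hv hne h
  refine ⟨⟨ht, fun x hx => hs.1.2 (hts hx)⟩, ?_⟩
  intro u hu hne hlab
  apply hne
  have h1 : u ∪ (s \ t) = s := by
    apply key
    · refine ⟨hu.1.mono Finset.subset_union_left, ?_⟩
      intro x hx
      rcases Finset.mem_union.1 (Finset.mem_coe.1 hx) with h | h
      · exact hu.2 h
      · exact hs.1.2 (Finset.mem_sdiff.1 h).1
    · have h2 : faceLabel (u ∪ (s \ t)) = faceLabel (t ∪ (s \ t)) := by
        simp only [faceLabel, Finset.sup_union] at hlab ⊢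
        rw [hlab]
      rw [h2, Finset.union_sdiff_of_subset hts]
  apply Finset.Subset.antisymm
  · intro x hxu
    by_contra hxt
    have hxs : x ∈ s := h1 ▸ Finset.mem_union_left _ hxu
    have hsub : t ⊆ s.erase x := fun y hy =>
      Finset.mem_erase.2 ⟨fun h => hxt (h ▸ hy), hts hy⟩
    have h3 : s.erase x = s := by
      apply key
      · exact ⟨ht.mono hsub, fun y hy => hs.1.2 (Finset.mem_of_mem_erase hy)⟩
      · apply le_antisymm
        · conv_lhs => rw [← Finset.insert_erase hxs]
          unfold faceLabel
          rw [Finset.sup_insert]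
          refine sup_le ?_ le_rfl
          have h4 : x ≤ faceLabel u := Finset.le_sup (f := id) hxu
          exact (hlab ▸ h4).trans (faceLabel_mono hsub)
        · exact faceLabel_mono (Finset.erase_subset _ _)
    exact (Finset.erase_eq_self.1 h3) hxs
  · intro x hx
    have hxs : x ∈ u ∪ (s \ t) := h1.symm ▸ hts hx
    rcases Finset.mem_union.1 hxs with h | h
    · exact h
    · exact absurd hx (Finset.mem_sdiff.1 h).2

/-- The Scarf complex of a monomial ideal. -/
def scarfComplex (I : Ideal (MvPolynomial σ k)) : PreAbstractSimplicialComplex (σ →₀ ℕ) where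
  faces := scarfFaces I
  isRelLowerSet_faces := fun _ hs =>
    ⟨hs.1.1, fun _ hts ht => scarfFaces_subset hs hts ht⟩

end MonomialIdeals

section Homogenization

variable (k : Type*) [Field k] {σ : Type*}

/-- The faces of dimension `n`. -/
def Face (K : PreAbstractSimplicialComplex (σ →₀ ℕ)) (n : ℕ) : Type _ :=
  {s : Finset (σ →₀ ℕ) // s ∈ K ∧ s.card = n + 1}

/-- The `n`-th module of the homogenized chain complex of `K`: the free module over the polynomial
ring with one basis element for each `n`-dimensional face. -/
abbrev Chain (K : PreAbstractSimplicialComplex (σ →₀ ℕ)) (n : ℕ) : Type _ :=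
  Face K n →₀ MvPolynomial σ k

open Classical in
/-- The codimension-one face opposite to the vertex `v`. -/
noncomputable def Face.remove {K : PreAbstractSimplicialComplex (σ →₀ ℕ)} {n : ℕ}
    (s : Face K (n + 1)) (v : {v // v ∈ s.1}) : Face K n :=
  ⟨s.1.erase v.1, by
    have hc : (s.1.erase v.1).card = n + 1 := by
      rw [Finset.card_erase_of_mem v.2, s.2.2]; rfl
    exact ⟨(K.isRelLowerSet_faces s.2.1).2 (Finset.erase_subset _ _)
      (Finset.card_pos.1 (by omega)), hc⟩⟩

open Classical in
/-- The homogenized simplicial boundary map, where `lt` is a strict total order of the vertices,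
`[s] ↦ ∑_{v ∈ s} ± (label of s / label of s \ {v}) [s \ {v}]`,
and the sign is `-1` to the number of vertices of `s` before `v`. -/
noncomputable def boundary (K : PreAbstractSimplicialComplex (σ →₀ ℕ))
    (lt : (σ →₀ ℕ) → (σ →₀ ℕ) → Prop) (n : ℕ) :
    Chain k K (n + 1) →ₗ[MvPolynomial σ k] Chain k K n :=
  Finsupp.linearCombination (MvPolynomial σ k) fun s : Face K (n + 1) =>
    ∑ v : {v // v ∈ s.1},
      Finsupp.single (s.remove v)
        ((-1) ^ (s.1.filter fun w => lt w v.1).card *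
          monomial (faceLabel s.1 - faceLabel (s.remove v).1) (1 : k))

/-- The augmentation, which sends the basis element of a vertex to the monomial labelling it. -/
noncomputable def augmentation (K : PreAbstractSimplicialComplex (σ →₀ ℕ)) :
    Chain k K 0 →ₗ[MvPolynomial σ k] MvPolynomial σ k :=
  Finsupp.linearCombination (MvPolynomial σ k) fun s : Face K 0 => monomial (faceLabel s.1) (1 : k)

variable {k}

/-- `K`, whose vertices are monomials and label themselves, supports a free resolution of `I`: the
homogenized chain complex `⋯ → Chain 2 → Chain 1 → Chain 0 → I → 0` is exact. A total order of the
vertices is used to fix the orientations of the faces; another one gives an isomorphic complex. -/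
def SupportsResolution (K : PreAbstractSimplicialComplex (σ →₀ ℕ))
    (I : Ideal (MvPolynomial σ k)) : Prop :=
  ∃ lt : (σ →₀ ℕ) → (σ →₀ ℕ) → Prop, IsStrictTotalOrder (σ →₀ ℕ) lt ∧
    LinearMap.range (augmentation k K) = I ∧
    Function.Exact (boundary k K lt 0) (augmentation k K) ∧
    ∀ n : ℕ, Function.Exact (boundary k K lt (n + 1)) (boundary k K lt n)

/-- A monomial ideal is Scarf if its Scarf complex supports a free resolution of it. -/
def IsScarf (I : Ideal (MvPolynomial σ k)) : Prop :=
  SupportsResolution (scarfComplex I) I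

end Homogenization

section ExtremalIdeals

/-- The variables `x_A` of the ring of the `q`-extremal ideal: nonempty subsets `A` of `[q]`. -/
abbrev ExtremalVar (q : ℕ) : Type := {A : Finset (Fin q) // A.Nonempty}

/-- The generator `ε_i`, the product of all the variables `x_A` with `i ∈ A`. -/
noncomputable def extremalGen (k : Type*) [Field k] (q : ℕ) (i : Fin q) :
    MvPolynomial (ExtremalVar q) k :=
  ∏ A : ExtremalVar q with i ∈ A.1, X A

/-- The `q`-extremal ideal `(ε_1, …, ε_q)`; it is the zero ideal of `k` for `q = 0`. -/
noncomputable def extremalIdeal (k : Type*) [Field k] (q : ℕ) :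
    Ideal (MvPolynomial (ExtremalVar q) k) :=
  Ideal.span (Set.range (extremalGen k q))

end ExtremalIdeals

end ScarfPowers

/-! The homogenized complex of `K` is multigraded. Its strand in degree `m` is the augmented
simplicial chain complex over `k` of the subcomplex of faces whose label divides `m`, so supporting
a resolution amounts to exactness of these scalar complexes (`supportsResolution_iff`). For the
Scarf complex only degrees that are lcms of minimal generators matter.

Suppose the generators of `I` embed among those of `J`, compatibly with divisibility into lcms, and
every generator of `J` dividing an lcm of embedded generators is itself embedded (`IsRestriction`).
Then the Scarf faces below such an lcm are the same for `I` and `J`, so the Scarf property descends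
from `J` to `I` (`IsScarf.of_isRestriction`).

Two embeddings into powers of extremal ideals satisfy this. For `ℰ_q ^ r` inside `ℰ_q ^ (r + 1)`,
multiply by `ε_i`: a generator without `ε_i` has exponent `r + 1` at `x_{[q] \ {i}}`, whereas
multiples of `ε_i` have at most `r`. For `ℰ_q ^ r` inside `ℰ_{q+1} ^ r`, send `ε_j` to `ε_j`: the
generators involving `ε_{q+1}` are exactly those divisible by `x_{{q+1}}`. -/

namespace ScarfPowers

open MvPolynomial

/-! ### Augmented simplicial chains over the field -/

section ScalarChains

variable (k : Type*) [Field k] {V W : Type*}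

open Classical in
/-- The augmented simplicial boundary map with coefficients in `k`; the empty set is a face. -/
noncomputable def scalarBoundary (lt : V → V → Prop) : (Finset V →₀ k) →ₗ[k] (Finset V →₀ k) :=
  Finsupp.linearCombination k fun s : Finset V =>
    ∑ v ∈ s, Finsupp.single (s.erase v) ((-1) ^ (s.filter fun w => lt w v).card)

open Classical in
theorem scalarBoundary_single (lt : V → V → Prop) (s : Finset V) (a : k) :
    scalarBoundary k lt (Finsupp.single s a) =
      ∑ v ∈ s, Finsupp.single (s.erase v) ((-1) ^ (s.filter fun w => lt w v).card * a) := by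
  simp [scalarBoundary, Finsupp.linearCombination_single, Finset.smul_sum, mul_comm]

/-- The boundary map commutes with relabelling the vertices along an embedding. -/
theorem scalarBoundary_mapDomain (φ : V ↪ W) (lt : W → W → Prop) (x : Finset V →₀ k) :
    scalarBoundary k lt (x.mapDomain (Finset.map φ)) =
      (scalarBoundary k (fun v w => lt (φ v) (φ w)) x).mapDomain (Finset.map φ) := by
  classical
  induction x using Finsupp.induction_linear with
  | zero => simp
  | add x y hx hy => simp only [Finsupp.mapDomain_add, map_add, hx, hy]
  | single s a =>
    rw [Finsupp.mapDomain_single, scalarBoundary_single, scalarBoundary_single,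
      Finsupp.mapDomain_finsetSum, Finset.sum_map]
    refine Finset.sum_congr rfl fun v _ => ?_
    rw [Finsupp.mapDomain_single, Finset.map_erase, Finset.filter_map, Finset.card_map]
    rfl

/-- Exactness of the augmented simplicial chain complex at chains on `F`, where `G` is the set of
faces of the next dimension. -/
def ScalarExact (lt : V → V → Prop) (F G : Set (Finset V)) : Prop :=
  ∀ x ∈ Finsupp.supported k k F,
    scalarBoundary k lt x = 0 ↔ ∃ y ∈ Finsupp.supported k k G, scalarBoundary k lt y = x

variable {k}

/-- Relabelling is injective on chains, commutes with the boundary, and maps chains on `F` onto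
chains on the image of `F`. Pulling the order back along `φ` keeps the signs equal. -/
theorem ScalarExact.comap (φ : V ↪ W) {lt : W → W → Prop} {F G : Set (Finset V)}
    (h : ScalarExact k lt (Finset.map φ '' F) (Finset.map φ '' G)) :
    ScalarExact k (fun v w => lt (φ v) (φ w)) F G := by
  have inj : Function.Injective (Finsupp.mapDomain (M := k) (Finset.map φ)) :=
    Finsupp.mapDomain_injective (Finset.map_injective φ)
  have hmap : ∀ (S : Set (Finset V)) (x' : Finset W →₀ k),
      x' ∈ Finsupp.supported k k (Finset.map φ '' S) ↔
        ∃ x ∈ Finsupp.supported k k S, x.mapDomain (Finset.map φ) = x' := by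
    intro S x'
    rw [← Finsupp.lmapDomain_supported, Submodule.mem_map]
    rfl
  intro x hx
  have h1 := h (x.mapDomain (Finset.map φ)) ((hmap F _).2 ⟨x, hx, rfl⟩)
  rw [scalarBoundary_mapDomain, ← Finsupp.mapDomain_zero (f := Finset.map φ), inj.eq_iff] at h1
  rw [h1]
  constructor
  · rintro ⟨y', hy', h2⟩
    obtain ⟨y, hy, rfl⟩ := (hmap G _).1 hy'
    rw [scalarBoundary_mapDomain] at h2
    exact ⟨y, hy, inj h2⟩
  · rintro ⟨y, hy, rfl⟩
    exact ⟨_, (hmap G _).2 ⟨y, hy, rfl⟩, scalarBoundary_mapDomain k φ lt y⟩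

theorem scalarExact_empty (lt : V → V → Prop) (G : Set (Finset V)) : ScalarExact k lt ∅ G := by
  intro x hx
  rw [Finsupp.supported_empty, Submodule.mem_bot] at hx
  subst hx
  exact ⟨fun _ => ⟨0, zero_mem _, map_zero _⟩, fun _ => map_zero _⟩

end ScalarChains

/-! ### Multigraded strands of the homogenized complex -/

section Degrees

variable {k : Type*} [Field k] {σ : Type*} (K : PreAbstractSimplicialComplex (σ →₀ ℕ))

/-- The `n`-dimensional faces of `K` whose label divides `m`. -/
def facesLE (n : ℕ) (m : σ →₀ ℕ) : Set (Finset (σ →₀ ℕ)) :=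
  {s | s ∈ K ∧ s.card = n + 1 ∧ faceLabel s ≤ m}

variable {K} {n : ℕ}

theorem exists_face_of_mem_facesLE {m : σ →₀ ℕ} {s : Finset (σ →₀ ℕ)} (hs : s ∈ facesLE K n m) :
    ∃ t : Face K n, t.1 = s ∧ faceLabel t.1 ≤ m :=
  ⟨⟨s, hs.1, hs.2.1⟩, rfl, hs.2.2⟩

open Classical in
/-- The part of multidegree `m` of a homogenized chain. -/
noncomputable def degreePart (m : σ →₀ ℕ) : Chain k K n →+ (Finset (σ →₀ ℕ) →₀ k) :=
  Finsupp.liftAddHom fun s =>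
    if faceLabel s.1 ≤ m then
      (Finsupp.singleAddHom s.1).comp (coeffAddMonoidHom (m - faceLabel s.1)) else 0

open Classical in
theorem degreePart_single_monomial (m u : σ →₀ ℕ) (s : Face K n) (a : k) :
    degreePart m (Finsupp.single s (monomial u a)) =
      if u + faceLabel s.1 = m then Finsupp.single s.1 a else 0 := by
  rw [degreePart, Finsupp.liftAddHom_apply_single]
  split_ifs with h1 h2 h2
  · subst h2; simp
  · have : u ≠ m - faceLabel s.1 := fun h => h2 (by rw [h, tsub_add_cancel_of_le h1])
    simp [coeff_monomial, this]
  · exact absurd (h2 ▸ le_add_self) h1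
  · rfl

theorem degreePart_apply (u : σ →₀ ℕ) (s : Face K n) (c : Chain k K n) :
    degreePart (u + faceLabel s.1) c s.1 = coeff u (c s) := by
  classical
  induction c using Finsupp.induction_linear with
  | zero => simp
  | add x y hx hy => simp [hx, hy]
  | single t p =>
    rw [degreePart, Finsupp.liftAddHom_apply_single]
    by_cases hts : t = s
    · subst hts; simp
    · have : t.1 ≠ s.1 := fun h => hts (Subtype.ext h)
      split_ifs <;> simp [hts, this]

theorem eq_of_degreePart_eq {c d : Chain k K n}
    (h : ∀ m, degreePart m c = degreePart m d) : c = d := by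
  ext s u
  have := DFunLike.congr_fun (h (u + faceLabel s.1)) s.1
  rwa [degreePart_apply, degreePart_apply] at this

theorem degreePart_mem_supported (m : σ →₀ ℕ) (c : Chain k K n) :
    degreePart m c ∈ Finsupp.supported k k (facesLE K n m) := by
  classical
  induction c using Finsupp.induction_linear with
  | zero => simp
  | add x y hx hy => rw [map_add]; exact add_mem hx hy
  | single s p =>
    rw [degreePart, Finsupp.liftAddHom_apply_single]
    split_ifs with h
    · exact Finsupp.single_mem_supported k _ ⟨s.2.1, s.2.2, h⟩
    · simp

/-- Needed to assemble liftings chosen degree by degree into a single chain. -/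
theorem finite_degreePart_ne_zero (c : Chain k K n) : {m | degreePart m c ≠ 0}.Finite := by
  classical
  refine (c.support.biUnion fun s =>
    (c s).support.image fun u => u + faceLabel s.1).finite_toSet.subset ?_
  intro m hm
  obtain ⟨s, hs⟩ := Finsupp.ne_iff.1 hm
  obtain ⟨s, rfl, hle⟩ :=
    exists_face_of_mem_facesLE (degreePart_mem_supported m c (Finsupp.mem_support_iff.2 hs))
  have hu : m - faceLabel s.1 + faceLabel s.1 = m := tsub_add_cancel_of_le hle
  have h1 := degreePart_apply (m - faceLabel s.1) s c
  rw [hu] at h1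
  have h2 : coeff (m - faceLabel s.1) (c s) ≠ 0 := h1 ▸ hs
  simp only [Finset.coe_biUnion, Set.mem_iUnion, Finset.coe_image, Set.mem_image, Finset.mem_coe]
  refine ⟨s, ?_, m - faceLabel s.1, mem_support_iff.2 h2, hu⟩
  refine Finsupp.mem_support_iff.2 fun h => ?_
  simp [h] at h2

/-- Every scalar chain on the faces with label dividing `m` is homogenized by a chain of
multidegree `m`. -/
theorem exists_homogenization (m : σ →₀ ℕ) {x : Finset (σ →₀ ℕ) →₀ k}
    (hx : x ∈ Finsupp.supported k k (facesLE K n m)) :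
    ∃ c : Chain k K n, degreePart m c = x ∧ ∀ m', m' ≠ m → degreePart m' c = 0 := by
  classical
  rw [Finsupp.supported_eq_span_single] at hx
  induction hx using Submodule.span_induction with
  | zero => exact ⟨0, by simp⟩
  | add x y _ _ hx hy =>
    obtain ⟨c, h1, h2⟩ := hx
    obtain ⟨d, h3, h4⟩ := hy
    refine ⟨c + d, by rw [map_add, h1, h3], fun m' hm' => ?_⟩
    rw [map_add, h2 m' hm', h4 m' hm', add_zero]
  | mem x h =>
    obtain ⟨s, hs, rfl⟩ := h
    obtain ⟨s, rfl, hle⟩ := exists_face_of_mem_facesLE hs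
    refine ⟨Finsupp.single s (monomial (m - faceLabel s.1) 1), ?_, fun m' hm' => ?_⟩
    · rw [degreePart_single_monomial, if_pos (tsub_add_cancel_of_le hle)]
    · rw [degreePart_single_monomial, if_neg]
      rw [tsub_add_cancel_of_le hle]
      exact hm'.symm
  | smul a x _ hx =>
    obtain ⟨c, h1, h2⟩ := hx
    -- `degreePart` is only bundled as an additive map, so compatibility with scalars of `k` is
    -- checked by hand.
    have key : ∀ m', degreePart m' (a • c) = a • degreePart m' c := by
      intro m'
      clear h1 h2
      induction c using Finsupp.induction_linear with
      | zero => simp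
      | add x y hx hy => simp only [smul_add, map_add, hx, hy]
      | single s p =>
        rw [Finsupp.smul_single, degreePart, Finsupp.liftAddHom_apply_single,
          Finsupp.liftAddHom_apply_single]
        split_ifs <;> simp
    exact ⟨a • c, by rw [key, h1], fun m' hm' => by rw [key, h2 m' hm', smul_zero]⟩

theorem chain_induction {P : Chain k K n → Prop} (zero : P 0)
    (add : ∀ c d, P c → P d → P (c + d))
    (single : ∀ s u a, P (Finsupp.single s (monomial u a))) (c : Chain k K n) : P c := by
  induction c using Finsupp.induction_linear with
  | zero => exact zero
  | add x y hx hy => exact add x y hx hy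
  | single s p =>
    induction p using MvPolynomial.induction_on' with
    | monomial u a => exact single s u a
    | add p q hp hq =>
      rw [Finsupp.single_add]
      exact add _ _ hp hq

/-- The monomial coefficients of the boundary are quotients of labels, so the degree is preserved
and only the signs survive in a strand. -/
theorem degreePart_boundary (lt : (σ →₀ ℕ) → (σ →₀ ℕ) → Prop) (m : σ →₀ ℕ)
    (c : Chain k K (n + 1)) :
    degreePart m (boundary k K lt n c) = scalarBoundary k lt (degreePart m c) := by
  classical
  induction c using chain_induction with
  | zero => simp
  | add x y hx hy => simp only [map_add, hx, hy]
  | single s u a =>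
    rw [degreePart_single_monomial, boundary, Finsupp.linearCombination_single, Finset.smul_sum,
      map_sum]
    have hterm : ∀ v : {v // v ∈ s.1},
        degreePart m (monomial u a • Finsupp.single (s.remove v)
          ((-1) ^ (s.1.filter fun w => lt w v.1).card *
            monomial (faceLabel s.1 - faceLabel (s.remove v).1) (1 : k))) =
        if u + faceLabel s.1 = m then Finsupp.single (s.1.erase v.1)
          ((-1) ^ (s.1.filter fun w => lt w v.1).card * a) else 0 := by
      intro v
      have hle : faceLabel (s.remove v).1 ≤ faceLabel s.1 :=
        faceLabel_mono (Finset.erase_subset _ _)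
      have hmon : (monomial u a : MvPolynomial σ k) •
          ((-1) ^ (s.1.filter fun w => lt w v.1).card *
            monomial (faceLabel s.1 - faceLabel (s.remove v).1) (1 : k)) =
          monomial (u + (faceLabel s.1 - faceLabel (s.remove v).1))
            ((-1) ^ (s.1.filter fun w => lt w v.1).card * a) := by
        rw [show ((-1 : MvPolynomial σ k)) = C (-1) by simp, ← C_pow, smul_eq_mul, mul_left_comm,
          monomial_mul, mul_one, C_mul_monomial]
      rw [Finsupp.smul_single, hmon, degreePart_single_monomial, add_assoc,
        tsub_add_cancel_of_le hle]
      rfl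
    rw [Finset.sum_congr rfl fun v _ => hterm v]
    split_ifs
    · rw [scalarBoundary_single]
      convert Finset.sum_coe_sort s.1 fun v => Finsupp.single (s.1.erase v)
          ((-1) ^ (s.1.filter fun w => lt w v).card * a)
    · simp

/-- In each strand the augmentation is the boundary from vertices to the empty face. Irreflexivity
makes the sign of a single vertex `+1`. -/
theorem single_coeff_augmentation (lt : (σ →₀ ℕ) → (σ →₀ ℕ) → Prop) [Std.Irrefl lt] (m : σ →₀ ℕ)
    (c : Chain k K 0) :
    Finsupp.single ∅ (coeff m (augmentation k K c)) = scalarBoundary k lt (degreePart m c) := by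
  classical
  induction c using chain_induction with
  | zero => simp
  | add x y hx hy => simp only [map_add, coeff_add, Finsupp.single_add, hx, hy]
  | single s u a =>
    rw [degreePart_single_monomial, augmentation, Finsupp.linearCombination_single, smul_eq_mul,
      monomial_mul, mul_one, coeff_monomial]
    split_ifs
    · obtain ⟨v, hv⟩ := Finset.card_eq_one.1 s.2.2
      rw [hv, scalarBoundary_single, Finset.sum_singleton, Finset.filter_singleton,
        if_neg (irrefl v), Finset.card_empty, pow_zero, one_mul]
      refine congrArg (Finsupp.single · a) ?_
      ext
      simp
    · simp

/-- Exactness of the homogenized complex can be tested in every multidegree. -/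
theorem exact_boundary_iff (lt : (σ →₀ ℕ) → (σ →₀ ℕ) → Prop) {M : Type*} [Zero M]
    {g : Chain k K n → M}
    (hg : ∀ c, g c = 0 ↔ ∀ m, scalarBoundary k lt (degreePart m c) = 0) :
    Function.Exact (boundary k K lt n) g ↔
      ∀ m, ScalarExact k lt (facesLE K n m) (facesLE K (n + 1) m) := by
  constructor
  · intro h m x hx
    obtain ⟨c, rfl, hc0⟩ := exists_homogenization m hx
    have hgc : g c = 0 ↔ scalarBoundary k lt (degreePart m c) = 0 := by
      rw [hg]
      refine ⟨fun h => h m, fun h m' => ?_⟩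
      by_cases hm : m' = m
      · rw [hm, h]
      · rw [hc0 m' hm, map_zero]
    rw [← hgc, h c]
    constructor
    · rintro ⟨y, rfl⟩
      exact ⟨degreePart m y, degreePart_mem_supported m y, (degreePart_boundary lt m y).symm⟩
    · rintro ⟨y, hy, hyc⟩
      obtain ⟨d, rfl, hd0⟩ := exists_homogenization m hy
      refine ⟨d, eq_of_degreePart_eq fun m' => ?_⟩
      rw [degreePart_boundary]
      by_cases hm : m' = m
      · rw [hm, hyc]
      · rw [hd0 m' hm, hc0 m' hm, map_zero]
  · intro h c
    rw [hg]
    constructor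
    · intro h0
      choose y hy hyc using fun m => (h m _ (degreePart_mem_supported m c)).1 (h0 m)
      choose d hd hd0 using fun m => exists_homogenization m (hy m)
      -- The preimage is the sum of the homogeneous liftings over the degrees in which `c` does not
      -- vanish.
      refine ⟨∑ m ∈ (finite_degreePart_ne_zero c).toFinset, d m, eq_of_degreePart_eq fun m => ?_⟩
      rw [degreePart_boundary, map_sum]
      by_cases hm : degreePart m c = 0
      · rw [Finset.sum_eq_zero, map_zero, hm]
        intro m' hm'
        refine hd0 m' m ?_
        rintro rfl
        simp [hm] at hm'
      · rw [Finset.sum_eq_single m, hd, hyc]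
        · exact fun m' _ hne => hd0 m' m hne.symm
        · intro h
          simp [hm] at h
    · rintro ⟨y, rfl⟩ m
      refine (h m _ (degreePart_mem_supported m _)).2 ⟨degreePart m y,
        degreePart_mem_supported m y, (degreePart_boundary lt m y).symm⟩

theorem supportsResolution_iff {I : Ideal (MvPolynomial σ k)} :
    SupportsResolution K I ↔ LinearMap.range (augmentation k K) = I ∧
      ∃ lt : (σ →₀ ℕ) → (σ →₀ ℕ) → Prop, IsStrictTotalOrder (σ →₀ ℕ) lt ∧
        ∀ n m, ScalarExact k lt (facesLE K n m) (facesLE K (n + 1) m) := by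
  have key : ∀ lt : (σ →₀ ℕ) → (σ →₀ ℕ) → Prop, IsStrictTotalOrder (σ →₀ ℕ) lt →
      ((Function.Exact (boundary k K lt 0) (augmentation k K) ∧
        ∀ n : ℕ, Function.Exact (boundary k K lt (n + 1)) (boundary k K lt n)) ↔
        ∀ n m, ScalarExact k lt (facesLE K n m) (facesLE K (n + 1) m)) := by
    intro lt _
    rw [exact_boundary_iff lt (g := augmentation k K)]
    · rw [forall_congr' fun n => exact_boundary_iff lt (g := boundary k K lt n) ?_]
      · constructor
        · rintro ⟨h0, h1⟩ (_ | n)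
          exacts [h0, h1 n]
        · exact fun h => ⟨h 0, fun n => h (n + 1)⟩
      · intro c
        simp only [← degreePart_boundary]
        exact ⟨fun h m => by rw [h, map_zero], fun h => eq_of_degreePart_eq fun m => by
          rw [h, map_zero]⟩
    · intro c
      simp only [← single_coeff_augmentation, Finsupp.single_eq_zero]
      rw [MvPolynomial.ext_iff]
      simp
  constructor
  · rintro ⟨lt, h1, h2, h3⟩
    exact ⟨h2, lt, h1, (key lt h1).1 h3⟩
  · rintro ⟨h2, lt, h1, h3⟩
    exact ⟨lt, h1, h2, (key lt h1).2 h3⟩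

end Degrees


/-! ### Descent of the Scarf property along restrictions -/

section Transfer

variable {k : Type*} [Field k] {σ τ : Type*}

theorem faceLabel_le_iff {s : Finset (σ →₀ ℕ)} {m : σ →₀ ℕ} :
    faceLabel s ≤ m ↔ ∀ v ∈ s, v ≤ m :=
  Finset.sup_le_iff

theorem le_faceLabel {s : Finset (σ →₀ ℕ)} {v : σ →₀ ℕ} (hv : v ∈ s) : v ≤ faceLabel s :=
  Finset.le_sup (f := id) hv

theorem faceLabel_singleton (v : σ →₀ ℕ) : faceLabel {v} = v :=
  Finset.sup_singleton

theorem faceLabel_apply_le_iff {s : Finset (σ →₀ ℕ)} {n : ℕ} (i : σ) :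
    faceLabel s i ≤ n ↔ ∀ v ∈ s, v i ≤ n := by
  classical
  induction s using Finset.induction_on with
  | empty => simp [faceLabel, bot_eq_zero]
  | insert v s _ ih =>
    rw [faceLabel] at ih ⊢
    rw [Finset.sup_insert, Finsupp.sup_apply, sup_le_iff, ih]
    simp

/-- Each coordinate of an lcm is attained by a member, which is why the set must be nonempty. -/
theorem le_faceLabel_iff {s : Finset (σ →₀ ℕ)} (hs : s.Nonempty) {w : σ →₀ ℕ} :
    w ≤ faceLabel s ↔ ∀ i, ∃ v ∈ s, w i ≤ v i := by
  rw [Finsupp.le_def]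
  refine forall_congr' fun i => ?_
  constructor
  · intro h
    obtain ⟨v, hv, hmax⟩ := s.exists_max_image (fun v => v i) hs
    exact ⟨v, hv, h.trans ((faceLabel_apply_le_iff i).2 hmax)⟩
  · rintro ⟨v, hv, h⟩
    exact h.trans (le_faceLabel hv i)

variable {I : Ideal (MvPolynomial σ k)} {J : Ideal (MvPolynomial τ k)}

/-- An embedding `φ` of monomials which identifies the minimal generators of `I` with minimal
generators of `J`, in such a way that divisibility of least common multiples is preserved and
that the image is closed under passing to divisors of least common multiples. -/
structure IsRestriction (I : Ideal (MvPolynomial σ k)) (J : Ideal (MvPolynomial τ k))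
    (φ : (σ →₀ ℕ) ↪ (τ →₀ ℕ)) : Prop where
  map_mem : ∀ v ∈ minimalGenerators I, φ v ∈ minimalGenerators J
  le_iff : ∀ s : Finset (σ →₀ ℕ), s.Nonempty → ∀ v, φ v ≤ faceLabel (s.map φ) ↔ v ≤ faceLabel s
  exists_eq : ∀ s ∈ taylorComplex I, ∀ w ∈ minimalGenerators J, w ≤ faceLabel (s.map φ) →
    ∃ v ∈ minimalGenerators I, φ v = w

namespace IsRestriction

variable {φ : (σ →₀ ℕ) ↪ (τ →₀ ℕ)} (h : IsRestriction I J φ)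
include h

theorem map_mem_taylorComplex {s : Finset (σ →₀ ℕ)} (hs : s ∈ taylorComplex I) :
    s.map φ ∈ taylorComplex J := by
  refine ⟨hs.1.map, fun w hw => ?_⟩
  obtain ⟨v, hv, rfl⟩ := Finset.mem_map.1 (Finset.mem_coe.1 hw)
  exact h.map_mem v (hs.2 hv)

theorem faceLabel_map_le_iff {s t : Finset (σ →₀ ℕ)} (ht : t.Nonempty) :
    faceLabel (s.map φ) ≤ faceLabel (t.map φ) ↔ faceLabel s ≤ faceLabel t := by
  simp only [faceLabel_le_iff, Finset.forall_mem_map, h.le_iff t ht]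

theorem exists_map_eq {s : Finset (σ →₀ ℕ)} (hs : s ∈ taylorComplex I) {t : Finset (τ →₀ ℕ)}
    (ht : t ∈ taylorComplex J) (hle : faceLabel t ≤ faceLabel (s.map φ)) :
    ∃ u ∈ taylorComplex I, u.map φ = t := by
  classical
  have hpre : ∀ w ∈ t, ∃ v ∈ minimalGenerators I, φ v = w := fun w hw =>
    h.exists_eq s hs w (ht.2 hw) (faceLabel_le_iff.1 hle w hw)
  have hu : (t.preimage φ φ.injective.injOn).map φ = t := by
    ext w
    simp only [Finset.mem_map, Finset.mem_preimage]
    constructor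
    · rintro ⟨v, hv, rfl⟩
      exact hv
    · intro hw
      obtain ⟨v, -, rfl⟩ := hpre w hw
      exact ⟨v, hw, rfl⟩
  refine ⟨_, ⟨?_, fun v hv => ?_⟩, hu⟩
  · rw [← Finset.map_nonempty (f := φ), hu]
    exact ht.1
  · obtain ⟨v', hv', heq⟩ := hpre _ (Finset.mem_preimage.1 (Finset.mem_coe.1 hv))
    exact φ.injective heq ▸ hv'

/-- Any face of `J` competing for the label of the image of `s` divides that label, hence is itself
an image; competitors on both sides correspond. -/
theorem map_mem_scarfComplex_iff {s : Finset (σ →₀ ℕ)} (hs : s ∈ taylorComplex I) :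
    s.map φ ∈ scarfComplex J ↔ s ∈ scarfComplex I := by
  constructor
  · intro hJ
    refine ⟨hs, fun t ht hne hlab => ?_⟩
    refine hJ.2 (t.map φ) (h.map_mem_taylorComplex ht)
      (fun heq => hne (Finset.map_injective φ heq)) (le_antisymm ?_ ?_)
    · rw [h.faceLabel_map_le_iff ht.1, hlab]
    · rw [h.faceLabel_map_le_iff hs.1, hlab]
  · intro hI
    refine ⟨h.map_mem_taylorComplex hs, fun t ht hne hlab => ?_⟩
    obtain ⟨u, hu, rfl⟩ := h.exists_map_eq hs ht hlab.ge
    refine hI.2 u hu (fun heq => hne (heq ▸ rfl)) (le_antisymm ?_ ?_)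
    · rw [← h.faceLabel_map_le_iff hu.1, hlab]
    · rw [← h.faceLabel_map_le_iff hs.1, hlab]

theorem image_facesLE {s : Finset (σ →₀ ℕ)} (hs : s ∈ taylorComplex I) (n : ℕ) :
    Finset.map φ '' facesLE (scarfComplex I) n (faceLabel s) =
      facesLE (scarfComplex J) n (faceLabel (s.map φ)) := by
  ext t
  constructor
  · rintro ⟨u, hu, rfl⟩
    exact ⟨(h.map_mem_scarfComplex_iff hu.1.1).2 hu.1, by rw [Finset.card_map, hu.2.1],
      (h.faceLabel_map_le_iff hs.1).2 hu.2.2⟩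
  · rintro ⟨ht, hcard, hle⟩
    obtain ⟨u, hu, rfl⟩ := h.exists_map_eq hs ht.1 hle
    exact ⟨u, ⟨(h.map_mem_scarfComplex_iff hu).1 ht, by rw [← hcard, Finset.card_map],
      (h.faceLabel_map_le_iff hs.1).1 hle⟩, rfl⟩

end IsRestriction

/-- A label divides `m` exactly when it divides the lcm of all generators dividing `m`. This reduces
to degrees that can be transported, since a restriction controls only lcms. -/
theorem facesLE_scarfComplex_eq (hfin : (minimalGenerators I).Finite) (m : σ →₀ ℕ) :
    (∀ n, facesLE (scarfComplex I) n m = ∅) ∨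
      ∃ s ∈ taylorComplex I, ∀ n,
        facesLE (scarfComplex I) n m = facesLE (scarfComplex I) n (faceLabel s) := by
  classical
  set s : Finset (σ →₀ ℕ) := hfin.toFinset.filter (· ≤ m) with hs
  have hmem : ∀ v, v ∈ s ↔ v ∈ minimalGenerators I ∧ v ≤ m := by simp [hs]
  have hsub : ∀ n, ∀ t ∈ facesLE (scarfComplex I) n m, t ⊆ s := fun n t ht v hv =>
    (hmem v).2 ⟨ht.1.1.2 hv, faceLabel_le_iff.1 ht.2.2 v hv⟩
  rcases s.eq_empty_or_nonempty with h0 | h0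
  · left
    intro n
    refine Set.eq_empty_of_forall_notMem fun t ht => ?_
    exact ht.1.1.1.ne_empty (Finset.subset_empty.1 (h0 ▸ hsub n t ht))
  · right
    refine ⟨s, ⟨h0, fun v hv => ((hmem v).1 hv).1⟩, fun n => ?_⟩
    refine Set.Subset.antisymm (fun t ht => ⟨ht.1, ht.2.1, faceLabel_mono (hsub n t ht)⟩) ?_
    exact fun t ht => ⟨ht.1, ht.2.1, ht.2.2.trans
      (faceLabel_le_iff.2 fun v hv => ((hmem v).1 hv).2)⟩

/-- The vertices of the Scarf complex are all the minimal generators. -/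
theorem singleton_mem_scarfComplex {v : σ →₀ ℕ} (hv : v ∈ minimalGenerators I) :
    {v} ∈ scarfComplex I := by
  refine ⟨⟨Finset.singleton_nonempty v, by simpa using hv⟩, fun t ht hne hlab => hne ?_⟩
  rw [faceLabel_singleton] at hlab
  refine Finset.eq_singleton_iff_nonempty_unique_mem.2 ⟨ht.1, fun w hw => ?_⟩
  have hle : w ≤ v := hlab ▸ le_faceLabel hw
  exact le_antisymm hle (hv.2 (ht.2 hw).1 hle)

theorem range_augmentation_scarfComplex :
    LinearMap.range (augmentation k (scarfComplex I)) =
      Ideal.span ((fun m => monomial m (1 : k)) '' minimalGenerators I) := by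
  rw [augmentation, Finsupp.range_linearCombination, Ideal.span]
  congr 1
  ext p
  constructor
  · rintro ⟨s, rfl⟩
    obtain ⟨v, hv⟩ := Finset.card_eq_one.1 s.2.2
    refine ⟨v, s.2.1.1.2 (by simp [hv]), ?_⟩
    simp only [hv, faceLabel_singleton]
  · rintro ⟨v, hv, rfl⟩
    exact ⟨⟨{v}, singleton_mem_scarfComplex hv, Finset.card_singleton v⟩,
      by simp only [faceLabel_singleton]⟩

theorem IsScarf.of_isRestriction {φ : (σ →₀ ℕ) ↪ (τ →₀ ℕ)} (h : IsRestriction I J φ)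
    (hfin : (minimalGenerators I).Finite)
    (hspan : Ideal.span ((fun m => monomial m (1 : k)) '' minimalGenerators I) = I)
    (hJ : IsScarf J) : IsScarf I := by
  obtain ⟨-, lt, hlt, hex⟩ := supportsResolution_iff.1 hJ
  refine supportsResolution_iff.2 ⟨range_augmentation_scarfComplex.trans hspan,
    fun v w => lt (φ v) (φ w), ?_, fun n m => ?_⟩
  · exact RelEmbedding.isStrictTotalOrder (RelEmbedding.preimage φ lt)
  · rcases facesLE_scarfComplex_eq hfin m with h0 | ⟨s, hs, hm⟩
    · rw [h0]
      exact scalarExact_empty _ _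
    · rw [hm, hm]
      apply ScalarExact.comap φ
      rw [h.image_facesLE hs, h.image_facesLE hs]
      exact hex n _

/-- An antichain of monomials is the set of minimal generators of the ideal it generates. -/
theorem minimalGenerators_span {S : Set (σ →₀ ℕ)} (hS : IsAntichain (· ≤ ·) S) :
    minimalGenerators (Ideal.span ((fun m => monomial m (1 : k)) '' S)) = S := by
  classical
  have hmem : ∀ m : σ →₀ ℕ,
      monomial m (1 : k) ∈ Ideal.span ((fun m => monomial m (1 : k)) '' S) ↔ ∃ s ∈ S, s ≤ m := by
    intro m
    rw [mem_ideal_span_monomial_image, support_monomial, if_neg one_ne_zero]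
    simp
  ext m
  simp only [minimalGenerators, hmem, Set.mem_ofPred_eq]
  constructor
  · rintro ⟨⟨s, hs, hle⟩, hmin⟩
    exact le_antisymm hle (hmin ⟨s, hs, le_rfl⟩ hle) ▸ hs
  · intro hm
    refine ⟨⟨m, hm, le_rfl⟩, ?_⟩
    rintro v ⟨s, hs, hsv⟩ hvm
    rwa [← hS.eq hs hm (hsv.trans hvm)]

end Transfer

/-! ### Generators of powers of extremal ideals -/

section Extremal

variable (k : Type*) [Field k]

/-- The exponent vector of the product `∏ i, ε_i ^ a i`. -/
noncomputable def extremalExponent {q : ℕ} (a : Fin q → ℕ) : ExtremalVar q →₀ ℕ :=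
  Finsupp.equivFunOnFinite.symm fun A => ∑ i ∈ A.1, a i

theorem extremalExponent_apply {q : ℕ} (a : Fin q → ℕ) (A : ExtremalVar q) :
    extremalExponent a A = ∑ i ∈ A.1, a i := rfl

theorem extremalExponent_add {q : ℕ} (a b : Fin q → ℕ) :
    extremalExponent (a + b) = extremalExponent a + extremalExponent b := by
  ext A
  simp [extremalExponent_apply, Finset.sum_add_distrib]

/-- The variable `x_{{i}}` occurs only in `ε_i`, so its exponent recovers `a i`. -/
theorem extremalExponent_le_iff {q : ℕ} {a b : Fin q → ℕ} :
    extremalExponent a ≤ extremalExponent b ↔ a ≤ b := by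
  constructor
  · intro h i
    simpa [extremalExponent_apply] using h ⟨{i}, Finset.singleton_nonempty i⟩
  · exact fun h A => Finset.sum_le_sum fun i _ => h i

theorem extremalGen_eq (q : ℕ) (i : Fin q) :
    extremalGen k q i = monomial (extremalExponent (Pi.single i 1)) 1 := by
  classical
  rw [extremalGen, monomial_eq, C_1, one_mul, Finsupp.prod_fintype _ _ (by simp),
    Finset.prod_filter]
  refine Finset.prod_congr rfl fun A _ => ?_
  rw [extremalExponent_apply, Finset.sum_pi_single']
  split_ifs <;> simp

/-- The exponent vectors of the products of `r` generators of the extremal ideal. -/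
def extremalExponents (q r : ℕ) : Set (ExtremalVar q →₀ ℕ) :=
  extremalExponent '' {a | ∑ i, a i = r}

theorem exists_eq_add_single {q r : ℕ} {a : Fin q → ℕ} (ha : ∑ i, a i = r + 1) {i : Fin q}
    (hi : a i ≠ 0) : ∃ b : Fin q → ℕ, ∑ i, b i = r ∧ a = b + Pi.single i 1 := by
  classical
  have h : a = (a - Pi.single i 1) + Pi.single i 1 := by
    refine (tsub_add_cancel_of_le fun j => ?_).symm
    rcases eq_or_ne j i with rfl | hj
    · simpa using Nat.one_le_iff_ne_zero.2 hi
    · simp [hj]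
  refine ⟨_, ?_, h⟩
  rw [h] at ha
  simp only [Pi.add_apply, Finset.sum_add_distrib, Finset.sum_pi_single', Finset.mem_univ,
    if_true] at ha
  exact Nat.succ_injective ha

theorem extremalIdeal_pow (q r : ℕ) :
    extremalIdeal k q ^ r =
      Ideal.span ((fun m => monomial m (1 : k)) '' extremalExponents q r) := by
  classical
  induction r with
  | zero =>
    have h0 : extremalExponent (0 : Fin q → ℕ) = 0 := by ext; simp [extremalExponent_apply]
    rw [pow_zero, Ideal.one_eq_top, eq_comm, Ideal.eq_top_iff_one]
    exact Ideal.subset_span ⟨_, ⟨0, by simp, rfl⟩, by simp [h0]⟩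
  | succ r ih =>
    rw [pow_succ, ih, extremalIdeal, Ideal.span_mul_span']
    congr 1
    ext p
    constructor
    · rintro ⟨_, ⟨_, ⟨a, ha, rfl⟩, rfl⟩, _, ⟨i, rfl⟩, rfl⟩
      refine ⟨_, ⟨a + Pi.single i 1, ?_, rfl⟩, ?_⟩
      · simpa [Finset.sum_add_distrib] using ha
      · simp [extremalGen_eq, extremalExponent_add, monomial_mul]
    · rintro ⟨_, ⟨a, ha, rfl⟩, rfl⟩
      obtain ⟨i, -, hi⟩ := Finset.exists_ne_zero_of_sum_ne_zero
        (show ∑ i, a i ≠ 0 from fun h => Nat.succ_ne_zero r (ha.symm.trans h))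
      obtain ⟨b, hb, rfl⟩ := exists_eq_add_single ha hi
      refine ⟨_, ⟨_, ⟨b, hb, rfl⟩, rfl⟩, _, ⟨i, rfl⟩, ?_⟩
      simp [extremalGen_eq, extremalExponent_add, monomial_mul]

theorem isAntichain_extremalExponents (q r : ℕ) : IsAntichain (· ≤ ·) (extremalExponents q r) := by
  rintro _ ⟨a, ha, rfl⟩ _ ⟨b, hb, rfl⟩ hne hle
  rw [extremalExponent_le_iff] at hle
  refine hne (congrArg _ (funext fun i => ?_))
  exact (Finset.sum_eq_sum_iff_of_le fun i _ => hle i).1 (ha.trans hb.symm) i (Finset.mem_univ i)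

theorem minimalGenerators_extremalIdeal_pow (q r : ℕ) :
    minimalGenerators (extremalIdeal k q ^ r) = extremalExponents q r := by
  rw [extremalIdeal_pow, minimalGenerators_span (isAntichain_extremalExponents q r)]

theorem finite_extremalExponents (q r : ℕ) : (extremalExponents q r).Finite := by
  refine Set.Finite.image _ ((Set.finite_Iic (fun _ : Fin q => r)).subset ?_)
  intro a ha i
  exact (Finset.single_le_sum (fun _ _ => Nat.zero_le _) (Finset.mem_univ i)).trans_eq ha

/-! ### The two restrictions -/

variable {k}

theorem IsScarf.extremalIdeal_pow_of_isRestriction {q r : ℕ} {τ : Type*}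
    {J : Ideal (MvPolynomial τ k)} {φ : (ExtremalVar q →₀ ℕ) ↪ (τ →₀ ℕ)}
    (h : IsRestriction (extremalIdeal k q ^ r) J φ) (hJ : IsScarf J) :
    IsScarf (extremalIdeal k q ^ r) := by
  refine IsScarf.of_isRestriction h ?_ ?_ hJ
  · rw [minimalGenerators_extremalIdeal_pow]
    exact finite_extremalExponents q r
  · rw [minimalGenerators_extremalIdeal_pow, extremalIdeal_pow]

/-- Multiplication by a generator identifies `ℰ_q ^ r` with a restriction of `ℰ_q ^ (r + 1)`. -/
theorem isRestriction_extremalIdeal_pow_succ {q : ℕ} (r : ℕ) (i : Fin q) :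
    IsRestriction (extremalIdeal k q ^ r) (extremalIdeal k q ^ (r + 1))
      (addRightEmbedding (extremalExponent (Pi.single i 1))) where
  map_mem v hv := by
    rw [minimalGenerators_extremalIdeal_pow] at hv ⊢
    obtain ⟨a, ha, rfl⟩ := hv
    refine ⟨a + Pi.single i 1, ?_, extremalExponent_add _ _⟩
    simpa [Finset.sum_add_distrib] using ha
  le_iff s hs v := by
    rw [le_faceLabel_iff hs, le_faceLabel_iff hs.map]
    simp
  exists_eq s hs w hw hle := by
    classical
    simp only [minimalGenerators_extremalIdeal_pow] at hw ⊢
    obtain ⟨a, ha, rfl⟩ := hw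
    by_cases hi : a i = 0
    -- Compare exponents at `x_A` with `A = [q] \ {i}`: the generator has `r + 1` there, but `ε_i`
    -- contributes nothing, so every `ε_i * ε^b` has at most `r`. The set `A` is nonempty because
    -- the sum `r + 1` over it is nonzero.
    · exfalso
      have hsum : ∑ j ∈ Finset.univ.erase i, a j = r + 1 := by
        rw [← ha, ← Finset.sum_erase_add _ _ (Finset.mem_univ i), hi, add_zero]
      have hne : (Finset.univ.erase i).Nonempty := by
        rw [Finset.nonempty_iff_ne_empty]
        intro h0
        simp [h0] at hsum
      obtain ⟨w, hw, hwle⟩ := (le_faceLabel_iff hs.1.map).1 hle ⟨_, hne⟩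
      obtain ⟨v, hv, rfl⟩ := Finset.mem_map.1 hw
      have hv' := hs.2 hv
      rw [minimalGenerators_extremalIdeal_pow] at hv'
      obtain ⟨b, hb, rfl⟩ := hv'
      have hble : ∑ j ∈ Finset.univ.erase i, b j ≤ r :=
        (Finset.sum_le_sum_of_subset (Finset.subset_univ _)).trans_eq hb
      simp only [addRightEmbedding_apply, Finsupp.add_apply, extremalExponent_apply, hsum,
        Finset.sum_pi_single', Finset.mem_erase, ne_eq, not_true_eq_false, false_and,
        if_false] at hwle
      omega
    · obtain ⟨b, hb, rfl⟩ := exists_eq_add_single ha hi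
      exact ⟨_, ⟨b, hb, rfl⟩, (extremalExponent_add _ _).symm⟩

/-- The substitution `x_A ↦ x_A * x_{A ∪ {q + 1}}`, on exponent vectors. -/
noncomputable def extendExponent (q : ℕ) : (ExtremalVar q →₀ ℕ) ↪ (ExtremalVar (q + 1) →₀ ℕ) where
  -- The exponent at `x_B` is that of `x_{B ∩ [q]}`. The default `0` applies only to `B = {q + 1}`.
  toFun v := Finsupp.equivFunOnFinite.symm fun B =>
    if h : (B.1.preimage Fin.castSucc (Fin.castSucc_injective q).injOn).Nonempty
    then v ⟨_, h⟩ else 0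
  inj' v w h := by
    ext A
    have hA : (A.1.map Fin.castSuccEmb).preimage Fin.castSucc (Fin.castSucc_injective q).injOn =
        A.1 := by
      ext; simp
    have := DFunLike.congr_fun h ⟨A.1.map Fin.castSuccEmb, A.2.map⟩
    simpa [hA, A.2] using this

theorem extendExponent_apply {q : ℕ} (v : ExtremalVar q →₀ ℕ) (B : ExtremalVar (q + 1)) :
    extendExponent q v B =
      if h : (B.1.preimage Fin.castSucc (Fin.castSucc_injective q).injOn).Nonempty
      then v ⟨_, h⟩ else 0 := rfl

theorem extendExponent_map {q : ℕ} (v : ExtremalVar q →₀ ℕ) (A : ExtremalVar q) :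
    extendExponent q v ⟨A.1.map Fin.castSuccEmb, A.2.map⟩ = v A := by
  have hA : (A.1.map Fin.castSuccEmb).preimage Fin.castSucc (Fin.castSucc_injective q).injOn =
      A.1 := by
    ext; simp
  simp [extendExponent_apply, hA, A.2]

theorem extendExponent_extremalExponent {q : ℕ} (a : Fin q → ℕ) :
    extendExponent q (extremalExponent a) =
      extremalExponent (Fin.snoc (α := fun _ => ℕ) a 0) := by
  classical
  ext B
  have hsum : ∑ i ∈ B.1.preimage Fin.castSucc (Fin.castSucc_injective q).injOn, a i =
      ∑ i ∈ B.1, Fin.snoc (α := fun _ => ℕ) a 0 i := by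
    rw [← Finset.sum_preimage Fin.castSucc B.1 (Fin.castSucc_injective q).injOn
      (Fin.snoc (α := fun _ => ℕ) a 0)]
    · simp
    · intro i _ hi
      rcases Fin.eq_castSucc_or_eq_last i with ⟨j, rfl⟩ | rfl
      · exact absurd ⟨j, rfl⟩ hi
      · simp
  rw [extendExponent_apply, extremalExponent_apply, ← hsum]
  split_ifs with h
  · rfl
  · rw [Finset.not_nonempty_iff_eq_empty.1 h, Finset.sum_empty]

/-- `ℰ_q ^ r` is identified with the restriction of `ℰ_{q + 1} ^ r` to the monomials which are not
divisible by `x_{{q + 1}}`. -/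
theorem isRestriction_extremalIdeal_succ_pow (q r : ℕ) :
    IsRestriction (extremalIdeal k q ^ r) (extremalIdeal k (q + 1) ^ r) (extendExponent q) where
  map_mem v hv := by
    rw [minimalGenerators_extremalIdeal_pow] at hv ⊢
    obtain ⟨a, ha, rfl⟩ := hv
    refine ⟨_, ?_, (extendExponent_extremalExponent a).symm⟩
    simpa [Fin.sum_univ_castSucc] using ha
  le_iff s hs v := by
    rw [le_faceLabel_iff hs, le_faceLabel_iff hs.map]
    constructor
    · intro h A
      obtain ⟨w, hw, hle⟩ := h ⟨A.1.map Fin.castSuccEmb, A.2.map⟩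
      obtain ⟨u, hu, rfl⟩ := Finset.mem_map.1 hw
      rw [extendExponent_map, extendExponent_map] at hle
      exact ⟨u, hu, hle⟩
    · intro h B
      by_cases hB : (B.1.preimage Fin.castSucc (Fin.castSucc_injective q).injOn).Nonempty
      · obtain ⟨u, hu, hle⟩ := h ⟨_, hB⟩
        refine ⟨_, Finset.mem_map_of_mem _ hu, ?_⟩
        rwa [extendExponent_apply, extendExponent_apply, dif_pos hB, dif_pos hB]
      · obtain ⟨u, hu⟩ := hs
        refine ⟨_, Finset.mem_map_of_mem _ hu, ?_⟩
        rw [extendExponent_apply, dif_neg hB]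
        exact Nat.zero_le _
  exists_eq s hs w hw hle := by
    simp only [minimalGenerators_extremalIdeal_pow] at hw ⊢
    obtain ⟨a, ha, rfl⟩ := hw
    -- At `x_{{q+1}}` every extended exponent is `0`, which forces the last entry of `a` to vanish.
    obtain ⟨w, hw, hwle⟩ := (le_faceLabel_iff hs.1.map).1 hle
      ⟨{Fin.last q}, Finset.singleton_nonempty _⟩
    obtain ⟨v, hv, rfl⟩ := Finset.mem_map.1 hw
    have hB : ¬ (({Fin.last q} : Finset (Fin (q + 1))).preimage Fin.castSucc
        (Fin.castSucc_injective q).injOn).Nonempty := by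
      rintro ⟨j, hj⟩
      simp [Fin.ext_iff, j.2.ne] at hj
    rw [extendExponent_apply, dif_neg hB, extremalExponent_apply, Finset.sum_singleton,
      Nat.le_zero] at hwle
    have hsnoc : Fin.snoc (α := fun _ => ℕ) (fun i => a i.castSucc) 0 = a := by
      rw [← hwle]
      exact Fin.snoc_init_self a
    refine ⟨_, ⟨fun i => a i.castSucc, ?_, rfl⟩, ?_⟩
    · rw [Set.mem_ofPred_eq, Fin.sum_univ_castSucc, hwle, add_zero] at ha
      exact ha
    · rw [extendExponent_extremalExponent, hsnoc]

end Extremal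

end ScarfPowers

theorem theoremt (k : Type*) [Field k] (q r : ℕ) (hq : 1 ≤ q) (hr : 1 ≤ r)
    (h : ScarfPowers.IsScarf (ScarfPowers.extremalIdeal k q ^ r)) :
    ScarfPowers.IsScarf (ScarfPowers.extremalIdeal k (q - 1) ^ r) ∧
      ScarfPowers.IsScarf (ScarfPowers.extremalIdeal k q ^ (r - 1)) := by
  obtain ⟨q, rfl⟩ := Nat.exists_eq_add_of_le' hq
  obtain ⟨r, rfl⟩ := Nat.exists_eq_add_of_le' hr
  exact ⟨h.extremalIdeal_pow_of_isRestriction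
      (ScarfPowers.isRestriction_extremalIdeal_succ_pow q (r + 1)),
    h.extremalIdeal_pow_of_isRestriction
      -- Any index would do; one exists because the number of generators is positive.
      (ScarfPowers.isRestriction_extremalIdeal_pow_succ r (Fin.last q))⟩
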